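/- Let $K$ be a nonempty set of regular uncountable cardinals, $\kappa_0=\min K$ and $\kappa^*=\sup K$. Assume that $|K|^+<\kappa_0$, that $\kappa_0$ is not the successor of a singular cardinal, and that GCH holds from some infinite cardinal $\psi$ on (that is, $2^\lambda=\lambda^+$ for all cardinals $\lambda\ge\psi$), where $\psi^{++}<\kappa_0$. Assume that $\langle C_\alpha\mid\alpha\le\kappa^*\text{ a singular limit ordinal}\rangle$ is a $\square_{(\kappa^*+1)}$-sequence, i.e. for all singular limit ordinals $\alpha\le\kappa^*$: $C_\alpha$ is club in $\alpha$; $\operatorname{otp}(C_\alpha)<\alpha$; and if $\beta$ is a limit point of $C_\alpha$ at which the sequence is defined, then $C_\beta=C_\alpha\cap\beta$. For each $\kappa\in K$ let $S_\kappa\subseteq E^\kappa_\omega=\{\alpha<\kappa\mid\operatorname{cf}(\alpha)=\omega\}$ be stationary in $\kappa$. Then there are sets $\bar S_\kappa\subseteq S_\kappa$ ($\kappa\in K$), each stationary in $\kappa$, such that the sequence $\langle T_\kappa=\kappa\smallsetminus\bar S_\kappa\mid\kappa\in K\rangle$ is strongly mutually fat. Here $\langle T_\kappa\mid\kappa\in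 K\rangle$ is strongly mutually fat if for every regular cardinal $\nu<\kappa_0$, every set $X\supseteq\kappa^*\cup K$ (for instance $X=H(\chi)$ with $\chi>\kappa^*$) and every structure $\mathfrak A$ on $X$ in a countable first-order language, there is an increasing and continuous sequence $\langle N_\alpha\mid\alpha\le\nu\rangle$ of elementary submodels of $\mathfrak A$, all containing $K$ as a subset, such that for all $\alpha\le\nu$ and $\kappa\in K$ we have $\sup(N_\alpha\cap\kappa)\in T_\kappa$ and, if $\alpha<\nu$, $\sup(N_\alpha\cap\kappa)\in N_{\alpha+1}$. -/

import Mathlib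

open Cardinal Ordinal Set

universe u

/-- `C` is a closed unbounded subset of the ordinal `α`. -/
def IsClubIn (α : Ordinal.{u}) (C : Set Ordinal.{u}) : Prop :=
  C ⊆ Iio α ∧ IsClub {x : Iio α | (x : Ordinal.{u}) ∈ C}

/-- `S` is a stationary subset of the ordinal `α`: it meets every club of `α`. -/
def IsStationaryIn (α : Ordinal.{u}) (S : Set Ordinal.{u}) : Prop :=
  S ⊆ Iio α ∧ IsStationary {x : Iio α | (x : Ordinal.{u}) ∈ S}

/-- The set `E^κ_ω` of ordinals below `κ` of cofinality `ω`. -/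
def cofOmega (κ : Cardinal.{u}) : Set Ordinal.{u} :=
  {α | α < κ.ord ∧ α.cof = ℵ₀}

/-- `α` is a singular limit ordinal: a limit ordinal with `cf α < α`. -/
def IsSingularOrdinal (α : Ordinal.{u}) : Prop :=
  Order.IsSuccLimit α ∧ α.cof.ord < α

/-- `β ∈ Lim C`: `β` is nonzero and `C ∩ β` is unbounded in `β`. -/
def IsLimitPointOf (β : Ordinal.{u}) (C : Set Ordinal.{u}) : Prop :=
  β ≠ 0 ∧ ∀ p < β, ∃ γ ∈ C, p < γ ∧ γ < β

/-- The order type of a set of ordinals. It lives one universe up; for a bounded set it is the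
lift of an ordinal of the original universe. -/
noncomputable def otp (C : Set Ordinal.{u}) : Ordinal.{u + 1} :=
  Ordinal.type (fun a b : C => a < b)

/-- `C` is a `□_(θ)`-sequence, indexed by the singular limit ordinals below `θ`
(the values of `C` at other ordinals are irrelevant). -/
structure IsSquareSequence (θ : Ordinal.{u}) (C : Ordinal.{u} → Set Ordinal.{u}) : Prop where
  club : ∀ α < θ, IsSingularOrdinal α → IsClubIn α (C α)
  otp_lt : ∀ α < θ, IsSingularOrdinal α → otp (C α) < Ordinal.lift.{u + 1} α
  coherent : ∀ α < θ, IsSingularOrdinal α → ∀ β < θ, IsSingularOrdinal β →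
    IsLimitPointOf β (C α) → C β = C α ∩ Iio β

/-- The GCH holds from the (infinite) cardinal `ψ` on. -/
def GCHFrom (ψ : Cardinal.{u}) : Prop :=
  ℵ₀ ≤ ψ ∧ ∀ c : Cardinal.{u}, ψ ≤ c → (2 : Cardinal.{u}) ^ c = Order.succ c

/-- The set of ordinals that are elements of `N`, where `N` is a subset of the set `X`. -/
def ordinalsOf {X : ZFSet.{u}} (N : Set X) : Set Ordinal.{u} :=
  {β | ∃ x ∈ N, (x : ZFSet.{u}) = β.toZFSet}

/-- `⟨N α | α ≤ ν⟩` is an increasing and continuous sequence of elementary submodels of the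
structure on `X` such that for all `α ≤ ν` and `κ ∈ N α ∩ K`, `sup (N α ∩ κ)` is an
element of `S κ` and (for `α < ν`, where there is a next model) of `N (α + 1)`. -/
structure WitnessesMutualFatness (K : Set Cardinal.{u}) (S : Cardinal.{u} → Set Ordinal.{u})
    (ν : Cardinal.{u}) {X : ZFSet.{u}} {L : FirstOrder.Language.{0, 0}} [L.Structure X]
    (N : Ordinal.{u} → L.ElementarySubstructure X) : Prop where
  increasing : StrictMonoOn N (Iic ν.ord)
  continuous : ∀ α ≤ ν.ord, Order.IsSuccLimit α → (N α : Set X) = ⋃ β ∈ Iio α, (N β : Set X)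
  sup_mem : ∀ α ≤ ν.ord, ∀ κ ∈ K, κ.ord ∈ ordinalsOf (N α : Set X) →
    sSup (ordinalsOf (N α : Set X) ∩ Iio κ.ord) ∈ S κ
  sup_mem_succ : ∀ α < ν.ord, ∀ κ ∈ K, κ.ord ∈ ordinalsOf (N α : Set X) →
    sSup (ordinalsOf (N α : Set X) ∩ Iio κ.ord) ∈ ordinalsOf (N (Order.succ α) : Set X)

/-- `⟨S κ | κ ∈ K⟩` is strongly mutually `ν`-fat. Algebras are structures in a countable first
order language; their underlying set is any set `X` that contains the ordinals below `sup K` and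
the elements of `K`. In particular `X` may be `H(χ)` for any `χ > sup K`, and it may be `sup K`
itself when this is not an element of `K`. "Strongly" means that all the models contain `K`
as a subset. -/
def IsStronglyMutuallyNuFat (K : Set Cardinal.{u}) (S : Cardinal.{u} → Set Ordinal.{u})
    (ν : Cardinal.{u}) : Prop :=
  ∀ X : ZFSet.{u}, (∀ β < (sSup K).ord, β.toZFSet ∈ X) → (∀ κ ∈ K, κ.ord.toZFSet ∈ X) →
    ∀ (L : FirstOrder.Language.{0, 0}) [Countable L.Symbols] [L.Structure X],
      ∃ N : Ordinal.{u} → L.ElementarySubstructure X,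
        WitnessesMutualFatness K S ν N ∧
          ∀ α ≤ ν.ord, ∀ κ ∈ K, κ.ord ∈ ordinalsOf (N α : Set X)

/-- `⟨S κ | κ ∈ K⟩` is strongly mutually fat: it is strongly mutually `ν`-fat for every regular
`ν < min K`. -/
def IsStronglyMutuallyFat (K : Set Cardinal.{u}) (S : Cardinal.{u} → Set Ordinal.{u}) : Prop :=
  ∀ ν : Cardinal.{u}, ν.IsRegular → (∀ κ ∈ K, ν < κ) → IsStronglyMutuallyNuFat K S ν

/-! Since `otp (C x) < x`, Fodor's lemma thins each `S κ` to a stationary `T κ` on which `otp (C x)`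
is constant. Such a set is nearly invisible to continuous sequences of regular uncountable length
`l`: if `f` is normal with `l ≤ f 0`, its values at limits are singular, and by coherence the sets
`C (f a)`, for `f a` a limit point of `C (f l)`, are initial segments of `C (f l)` with strictly
growing order types. So at most one such `f a` lies in `T κ`, and club many `a < l` avoid `T κ`
(`IsSquareSequence.exists_isClub_forall_notMem`).

Given `ν`, choose `l ≥ ν` regular uncountable with `|K| < l < min K`, and build a chain of Skolem
hulls of length `l`, each containing the suprema of the earlier ones. The functions `α ↦ sup (N α ∩
κ)` are normal, and the `|K|` clubs obtained from them meet in a club of `l`. Its increasing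
enumeration selects the required models. -/

/-! ### Clubs, diagonal intersections and Fodor's lemma. -/

theorem isClub_of_limit_mem {o : Ordinal.{u}} {D : Set Ordinal.{u}}
    (hcl : ∀ a < o, Order.IsSuccLimit a → (∀ b < a, ∃ c ∈ D, b < c ∧ c < a) → a ∈ D)
    (hub : ∀ b < o, ∃ c ∈ D, b < c ∧ c < o) : IsClub {x : Iio o | (x : Ordinal.{u}) ∈ D} := by
  refine ⟨fun d hd hne _ a ha => ?_, fun b => ?_⟩
  · by_cases had : a ∈ d
    · exact hd had
    have hlt : ∀ c ∈ d, c < a := fun c hc => lt_of_le_of_ne (ha.1 hc) (by rintro rfl; exact had hc)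
    have hd' : ∀ b < (a : Ordinal.{u}), ∃ c ∈ d, b < (c : Ordinal.{u}) := by
      intro b hb
      by_contra! h
      have : a ≤ ⟨b, hb.trans a.2⟩ := ha.2 fun c hc => h c hc
      exact absurd hb (not_lt.2 this)
    refine hcl a a.2 ⟨?_, ?_⟩ fun b hb => ?_
    · obtain ⟨c, hc⟩ := hne
      rw [isMin_iff_eq_bot]
      exact (lt_of_le_of_lt bot_le (show (c : Ordinal.{u}) < a from hlt c hc)).ne'
    · intro b hb
      obtain ⟨c, hc, hbc⟩ := hd' b hb.lt
      exact hb.2 hbc (hlt c hc)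
    · obtain ⟨c, hc, hbc⟩ := hd' b hb
      exact ⟨c, hd hc, hbc, hlt c hc⟩
  · obtain ⟨c, hc, hbc, hco⟩ := hub b b.2
    exact ⟨⟨c, hco⟩, hc, hbc.le⟩

theorem IsClubIn.exists_gt {δ : Ordinal.{u}} {C : Set Ordinal.{u}} (hC : IsClubIn δ C)
    (hδ : Order.IsSuccLimit δ) {p : Ordinal.{u}} (hp : p < δ) : ∃ γ ∈ C, p < γ ∧ γ < δ := by
  obtain ⟨c, hc, hpc⟩ := hC.2.isCofinal ⟨Order.succ p, hδ.succ_lt hp⟩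
  exact ⟨c, hc, Order.succ_le_iff.1 hpc, c.2⟩

theorem cof_Iio_ord {κ : Cardinal.{u}} (hκ : κ.IsRegular) :
    Order.cof (Iio κ.ord) = Cardinal.lift.{u + 1} κ := by
  rw [Ordinal.cof_Iio, ← Ordinal.lift_cof, hκ.cof_ord]

theorem iSup_nat_lt_ord {κ : Cardinal.{u}} (hκ : κ.IsRegular) (hκ' : ℵ₀ < κ)
    {g : ℕ → Ordinal.{u}} (hg : ∀ n, g n < κ.ord) : ⨆ n, g n < κ.ord := by
  refine Ordinal.lift_iSup_lt_of_lt_cof ?_ hg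
  simpa [hκ.cof_ord] using hκ'

/-- Iterating a progressive function on a regular uncountable cardinal reaches a limit point. -/
theorem exists_limit_of_progressive {κ : Cardinal.{u}} (hκ : κ.IsRegular) (hκ' : ℵ₀ < κ)
    {h : Ordinal.{u} → Ordinal.{u}} (hh : ∀ a < κ.ord, a < h a ∧ h a < κ.ord)
    {b : Ordinal.{u}} (hb : b < κ.ord) :
    ∃ g : ℕ → Ordinal.{u}, StrictMono g ∧ g 0 = b ∧ (∀ n, g (n + 1) = h (g n)) ∧
      ∃ x < κ.ord, Order.IsSuccLimit x ∧ (∀ n, g n < x) ∧ ∀ p < x, ∃ n, p < g n := by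
  let g : ℕ → Ordinal.{u} := fun n => h^[n] b
  have hs : ∀ n, g (n + 1) = h (g n) := fun n => Function.iterate_succ_apply' h n b
  have hg : ∀ n, g n < κ.ord := by
    intro n
    induction n with
    | zero => exact hb
    | succ n ih => rw [hs]; exact (hh _ ih).2
  have hm : StrictMono g := strictMono_nat_of_lt_succ fun n => by
    rw [hs]; exact (hh _ (hg n)).1
  have hlt : ∀ n, g n < ⨆ n, g n := fun n =>
    (hm n.lt_succ_self).trans_le (Ordinal.le_iSup g (n + 1))
  have hex : ∀ p < ⨆ n, g n, ∃ n, p < g n := fun p hp => Ordinal.lt_iSup_iff.1 hp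
  refine ⟨g, hm, rfl, hs, ⨆ n, g n, iSup_nat_lt_ord hκ hκ' hg, ⟨?_, ?_⟩, hlt, hex⟩
  · rw [isMin_iff_eq_bot]
    exact (lt_of_le_of_lt bot_le (hlt 0)).ne'
  · intro p hp
    obtain ⟨n, hn⟩ := hex p hp.lt
    exact hp.2 hn (hlt n)

theorem IsClub.mem_of_limit {o : Ordinal.{u}} {D : Set (Iio o)} (hD : IsClub D) {x : Iio o}
    (hx : ∀ p < x, ∃ c ∈ D, p < c ∧ c < x) {p : Iio o} (hp : p < x) : x ∈ D := by
  refine hD.isLUB_mem (t := {c | c ∈ D ∧ c < x}) (fun c hc => hc.1) ?_ ⟨fun c hc => hc.2.le, ?_⟩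
  · obtain ⟨c, hc, -, hcx⟩ := hx p hp
    exact ⟨c, hc, hcx⟩
  · intro y hy
    by_contra! hyx
    obtain ⟨c, hc, hyc, hcx⟩ := hx y hyx
    exact absurd (hy ⟨hc, hcx⟩) (not_le.2 hyc)

/-- The diagonal intersection of clubs in a regular uncountable cardinal is a club. -/
theorem isClub_diagonal {κ : Cardinal.{u}} (hκ : κ.IsRegular) (hκ' : ℵ₀ < κ)
    (D : Ordinal.{u} → Set (Iio κ.ord)) (hD : ∀ i, IsClub (D i)) :
    IsClub {x : Iio κ.ord | ∀ i < (x : Ordinal.{u}), x ∈ D i} := by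
  have hcof : Order.cof (Iio κ.ord) ≠ ℵ₀ := by
    rw [cof_Iio_ord hκ]
    exact (by simpa using hκ' : ℵ₀ < Cardinal.lift.{u + 1} κ).ne'
  have hlim : Order.IsSuccLimit κ.ord := Cardinal.isSuccLimit_ord hκ.aleph0_le
  have hstep : ∀ a, a < κ.ord → ∃ c, a < c ∧ ∃ hc : c < κ.ord, ∀ i ≤ a, ⟨c, hc⟩ ∈ D i := by
    intro a ha
    have hI : IsClub (⋂ i : Iio (Order.succ a), D i) := by
      refine IsClub.iInter hcof ?_ fun i => hD i
      rw [cof_Iio_ord hκ, Cardinal.mk_Iio_ordinal, Cardinal.lift_id, Cardinal.lift_id, Cardinal.lift_lt]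
      exact Cardinal.lt_ord.1 (hlim.succ_lt ha)
    obtain ⟨c, hc, hac⟩ := hI.isCofinal ⟨Order.succ a, hlim.succ_lt ha⟩
    rw [mem_iInter] at hc
    exact ⟨c, Order.succ_le_iff.1 hac, c.2, fun i hi => hc ⟨i, Order.lt_succ_of_le hi⟩⟩
  choose! h hah hhκ hhD using hstep
  refine ⟨fun d hd hne _ a ha i hi => ?_, fun b => ?_⟩
  · obtain ⟨c, hc, hic⟩ : ∃ c ∈ d, (⟨i, hi.trans a.2⟩ : Iio κ.ord) < c := by
      by_contra! hcon
      exact absurd (show (⟨i, hi.trans a.2⟩ : Iio κ.ord) < a from hi) (not_lt.2 (ha.2 hcon))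
    -- Only the tail of `d` above `i` need lie in `D i`; it has the same supremum.
    refine (hD i).isLUB_mem (t := {x ∈ d | c ≤ x}) (fun x hx => hd hx.1 i (hic.trans_le hx.2))
      ⟨c, hc, le_rfl⟩ ⟨fun x hx => ha.1 hx.1, fun y hy => ha.2 fun x hx => ?_⟩
    rcases le_total c x with h | h
    · exact hy ⟨hx, h⟩
    · exact h.trans (hy ⟨hc, le_rfl⟩)
  · obtain ⟨g, hm, h0, hs, x, hxκ, -, hgx, hex⟩ :=
      exists_limit_of_progressive hκ hκ' (h := h) (fun a ha => ⟨hah a ha, hhκ a ha⟩) b.2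
    refine ⟨⟨x, hxκ⟩, fun i hi => ?_, (h0 ▸ hgx 0).le⟩
    refine (hD i).mem_of_limit (p := ⟨g 0, (hgx 0).trans hxκ⟩) (fun p hp => ?_) (hgx 0)
    obtain ⟨n, hn⟩ := hex (max i p) (max_lt hi hp)
    have hgn := (hgx n).trans hxκ
    refine ⟨⟨h (g n), hhκ _ hgn⟩, hhD _ hgn i ((le_max_left _ _).trans hn.le), ?_, ?_⟩
    · exact ((le_max_right _ _).trans_lt hn).trans (hah _ hgn)
    · change h (g n) < x
      rw [← hs]
      exact hgx _

/-- **Fodor's lemma**. -/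
theorem IsStationaryIn.exists_fiber {κ : Cardinal.{u}} (hκ : κ.IsRegular) (hκ' : ℵ₀ < κ)
    {S : Set Ordinal.{u}} (hS : IsStationaryIn κ.ord S) {r : Ordinal.{u} → Ordinal.{u}}
    (hr : ∀ a ∈ S, r a < a) : ∃ o, IsStationaryIn κ.ord {a ∈ S | r a = o} := by
  by_contra! hcon
  have : ∀ o, ∃ D : Set (Iio κ.ord), IsClub D ∧
      Disjoint {x : Iio κ.ord | (x : Ordinal.{u}) ∈ {a ∈ S | r a = o}} D := by
    intro o
    rw [← not_isStationary_iff]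
    exact fun h => hcon o ⟨fun a ha => hS.1 ha.1, h⟩
  choose D hD hdisj using this
  obtain ⟨x, hxS, hx⟩ := hS.2 (isClub_diagonal hκ hκ' D hD)
  exact disjoint_left.1 (hdisj (r x)) ⟨hxS, rfl⟩ (hx _ (hr x hxS))

/-- Otherwise `B` embeds in `A ⊆ B`, a strictly increasing self-map of a well-order that moves `γ`
downwards. -/
theorem otp_lt_otp {A B : Set Ordinal.{u}} {x γ : Ordinal.{u}} (hAB : A ⊆ B) (hA : ∀ y ∈ A, y < x)
    (hγ : γ ∈ B) (hx : x ≤ γ) : otp A < otp B := by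
  by_contra! h
  obtain ⟨g⟩ := Ordinal.type_le_iff'.1 h
  let e : B → B := fun b => ⟨g b, hAB (g b).2⟩
  have he : StrictMono e := fun a b hab => g.map_rel_iff.2 hab
  have h1 : (⟨γ, hγ⟩ : B) ≤ e ⟨γ, hγ⟩ := he.le_apply
  exact absurd ((hA _ (g ⟨γ, hγ⟩).2).trans_le hx) (not_lt.2 h1)

/-! ### Normal functions and limit points of clubs. -/

/-- `f` is strictly increasing and continuous on the ordinals `≤ o`. -/
structure IsNormalUpTo (o : Ordinal.{u}) (f : Ordinal.{u} → Ordinal.{u}) : Prop where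
  strictMonoOn : StrictMonoOn f (Iic o)
  exists_lt : ∀ a ≤ o, Order.IsSuccLimit a → ∀ p < f a, ∃ b < a, p < f b

namespace IsNormalUpTo

variable {o : Ordinal.{u}} {f : Ordinal.{u} → Ordinal.{u}}

theorem isSuccLimit (hf : IsNormalUpTo o f) {a : Ordinal.{u}} (ha : a ≤ o)
    (hl : Order.IsSuccLimit a) : Order.IsSuccLimit (f a) := by
  have h0 : (0 : Ordinal.{u}) < a := hl.bot_lt
  refine ⟨?_, fun p hp => ?_⟩
  · rw [isMin_iff_eq_bot]
    exact (lt_of_le_of_lt bot_le (hf.strictMonoOn (h0.le.trans ha) ha h0)).ne'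
  · obtain ⟨b, hb, hpb⟩ := hf.exists_lt a ha hl p hp.lt
    exact hp.2 hpb (hf.strictMonoOn (hb.le.trans ha) ha hb)

theorem cof_apply (hf : IsNormalUpTo o f) {a : Ordinal.{u}} (ha : a ≤ o)
    (hl : Order.IsSuccLimit a) : (f a).cof = a.cof := by
  have h : f a = ⨆ i : Iio a, f i := by
    apply le_antisymm
    · by_contra! h
      obtain ⟨b, hb, hlt⟩ := hf.exists_lt a ha hl _ h
      exact absurd (Ordinal.le_iSup (fun i : Iio a => f i) ⟨b, hb⟩) (not_le.2 hlt)
    · exact Ordinal.iSup_le fun i => (hf.strictMonoOn (le_trans i.2.le ha) ha i.2).le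
  rw [h]
  refine Ordinal.cof_iSup_Iio (f := fun i : Iio a => f i) (fun i j hij => ?_) hl.isSuccPrelimit
  exact hf.strictMonoOn (le_trans i.2.le ha) (le_trans j.2.le ha) hij

/-- The cofinality of `f a` is that of `a`, hence at most `a ≤ o ≤ f 0 < f a`. -/
theorem isSingularOrdinal (hf : IsNormalUpTo o f) (h0 : o ≤ f 0) {a : Ordinal.{u}} (ha : a ≤ o)
    (hl : Order.IsSuccLimit a) : IsSingularOrdinal (f a) := by
  refine ⟨hf.isSuccLimit ha hl, ?_⟩
  rw [hf.cof_apply ha hl]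
  exact ((Ordinal.ord_cof_le a).trans ha).trans_lt
    (h0.trans_lt (hf.strictMonoOn (bot_le : (0 : Ordinal.{u}) ≤ o) ha hl.bot_lt))

end IsNormalUpTo

/-- Closure comes from continuity of `f`; unboundedness from interleaving values of `f` with points
of `C` for `ω` steps. The bound `m` serves to discard the indices up to one bad one. -/
theorem isClub_isLimitPointOf {l : Cardinal.{u}} (hl : l.IsRegular) (hl' : ℵ₀ < l)
    {f : Ordinal.{u} → Ordinal.{u}} (hf : IsNormalUpTo l.ord f) {C : Set Ordinal.{u}}
    (hC : IsClubIn (f l.ord) C) (m : Ordinal.{u}) (hm : m < l.ord) :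
    IsClub {x : Iio l.ord |
      (x : Ordinal.{u}) ∈ {a | Order.IsSuccLimit a ∧ IsLimitPointOf (f a) C ∧ m < a}} := by
  have hlim : Order.IsSuccLimit l.ord := Cardinal.isSuccLimit_ord hl.aleph0_le
  apply isClub_of_limit_mem
  · intro a ha hal h
    refine ⟨hal, ⟨(hf.isSuccLimit ha.le hal).bot_lt.ne', fun p hp => ?_⟩, ?_⟩
    · obtain ⟨b, hb, hpb⟩ := hf.exists_lt a ha.le hal p hp
      obtain ⟨c, hc, hbc, hca⟩ := h b hb
      have hfc := hf.strictMonoOn (hca.trans ha).le ha.le hca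
      obtain ⟨γ, hγ, h1, h2⟩ := hc.2.1.2 p
        (hpb.trans (hf.strictMonoOn (hb.trans ha).le (hca.trans ha).le hbc))
      exact ⟨γ, hγ, h1, h2.trans hfc⟩
    · obtain ⟨c, hc, -, hca⟩ := h 0 hal.bot_lt
      exact hc.2.2.trans hca
  · have hstep : ∀ a, a < l.ord → ∃ b, a < b ∧ b < l.ord ∧ ∃ γ ∈ C, f a < γ ∧ γ < f b := by
      intro a ha
      obtain ⟨γ, hγ, h1, h2⟩ := hC.exists_gt (hf.isSuccLimit le_rfl hlim)
        (hf.strictMonoOn ha.le (le_refl l.ord) ha)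
      obtain ⟨b, hb, hlt⟩ := hf.exists_lt _ le_rfl hlim γ h2
      have hlt' := h1.trans hlt
      exact ⟨b, (hf.strictMonoOn.lt_iff_lt ha.le hb.le).1 hlt', hb, γ, hγ, h1, hlt⟩
    choose! h hah hhl hγ using hstep
    intro b hb
    obtain ⟨g, hg, h0, hs, x, hxl, hlx, hgx, hex⟩ := exists_limit_of_progressive hl hl' (h := h)
      (fun a ha => ⟨hah a ha, hhl a ha⟩) (max_lt hb hm)
    have hmx := h0 ▸ hgx 0
    refine ⟨x, ⟨hlx, ⟨(hf.isSuccLimit hxl.le hlx).bot_lt.ne', fun p hp => ?_⟩, ?_⟩, ?_, hxl⟩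
    · obtain ⟨c, hc, hpc⟩ := hf.exists_lt x hxl.le hlx p hp
      obtain ⟨n, hn⟩ := hex c hc
      have hgl := fun n => (hgx n).trans hxl
      obtain ⟨γ, hγC, h1, h2⟩ := hγ (g n) (hgl n)
      refine ⟨γ, hγC, (hpc.trans (hf.strictMonoOn (hc.trans hxl).le (hgl n).le hn)).trans h1, ?_⟩
      rw [← hs] at h2
      exact h2.trans (hf.strictMonoOn (hgl _).le hxl.le (hgx _))
    · exact (le_max_right _ _).trans_lt hmx
    · exact (le_max_left _ _).trans_lt hmx

/-! ### Square sequences and sets of constant order type. -/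

/-- A set on which `otp (C x)` is constant is avoided by club many values of a continuous sequence
of regular uncountable length. -/
theorem IsSquareSequence.exists_isClub_forall_notMem {θ : Ordinal.{u}}
    {C : Ordinal.{u} → Set Ordinal.{u}} (hC : IsSquareSequence θ C)
    {l : Cardinal.{u}} (hl : l.IsRegular) (hl' : ℵ₀ < l)
    {f : Ordinal.{u} → Ordinal.{u}} (hf : IsNormalUpTo l.ord f) (h0 : l.ord ≤ f 0)
    (hθ : f l.ord < θ) {T : Set Ordinal.{u}} {o : Ordinal.{u + 1}}
    (hT : ∀ x ∈ T, x < θ → IsSingularOrdinal x → otp (C x) = o) :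
    ∃ D : Set (Iio l.ord), IsClub D ∧ ∀ a ∈ D, f a ∉ T := by
  have hlim : Order.IsSuccLimit l.ord := Cardinal.isSuccLimit_ord hl.aleph0_le
  have hδ := hf.isSingularOrdinal h0 le_rfl hlim
  have hclub := hC.club _ hθ hδ
  -- If some limit point `f b` falls in `T`, no later one does, so the club starts past `b`;
  -- otherwise all limit points will do.
  by_cases hb : ∃ b < l.ord, Order.IsSuccLimit b ∧ IsLimitPointOf (f b) (C (f l.ord)) ∧ f b ∈ T
  · obtain ⟨b, hbl, hb, hbC, hbT⟩ := hb
    refine ⟨_, isClub_isLimitPointOf hl hl' hf hclub b hbl, fun a ha haT => ?_⟩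
    obtain ⟨hal, haC, hba⟩ := ha
    have ha' : (a : Ordinal.{u}) ≤ l.ord := a.2.le
    have hθ' : ∀ c ≤ l.ord, f c < θ := fun c hc =>
      (hf.strictMonoOn.monotoneOn hc (le_refl l.ord) hc).trans_lt hθ
    have hfab := hf.strictMonoOn hbl.le ha' hba
    have sa := hf.isSingularOrdinal h0 ha' hal
    have sb := hf.isSingularOrdinal h0 hbl.le hb
    have ea := hC.coherent _ hθ hδ _ (hθ' _ ha') sa haC
    have eb := hC.coherent _ hθ hδ _ (hθ' _ hbl.le) sb hbC
    obtain ⟨γ, hγ, h1, h2⟩ := haC.2 _ hfab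
    have hlt : otp (C (f b)) < otp (C (f a)) := by
      rw [ea, eb]
      exact otp_lt_otp (x := f b) (fun y hy => ⟨hy.1, lt_trans hy.2 hfab⟩) (fun y hy => hy.2)
        ⟨hγ, h2⟩ h1.le
    rw [hT _ haT (hθ' _ ha') sa, hT _ hbT (hθ' _ hbl.le) sb] at hlt
    exact hlt.false
  · refine ⟨_, isClub_isLimitPointOf hl hl' hf hclub 0 hlim.bot_lt, fun a ha haT =>
      hb ⟨a, a.2, ha.1, ha.2.1, haT⟩⟩

/-- A stationary set of ordinals of cofinality `ω` can be thinned out so that `otp (C x)` is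
constant on it. -/
theorem IsSquareSequence.exists_stationary_otp_const {θ : Ordinal.{u}}
    {C : Ordinal.{u} → Set Ordinal.{u}} (hC : IsSquareSequence θ C)
    {κ : Cardinal.{u}} (hκ : κ.IsRegular) (hκ' : ℵ₀ < κ) {S : Set Ordinal.{u}}
    (hSω : S ⊆ cofOmega κ) (hS : IsStationaryIn κ.ord S) :
    ∃ T ⊆ S, IsStationaryIn κ.ord T ∧
      ∃ o, ∀ x ∈ T, x < θ → IsSingularOrdinal x → otp (C x) = o := by
  have hr : ∀ a, ∃ b, (a ∈ S → b < a) ∧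
      (a < θ → IsSingularOrdinal a → otp (C a) = Ordinal.lift.{u + 1} b) := by
    intro a
    by_cases h : a < θ ∧ IsSingularOrdinal a
    · obtain ⟨b, hb, e⟩ := Ordinal.lt_lift_iff.1 (hC.otp_lt a h.1 h.2)
      exact ⟨b, fun _ => by simpa using hb, fun _ _ => e.symm⟩
    -- Where the square sequence is undefined the value `0` is still regressive, as points of `S`
    -- have cofinality `ω` and so are nonzero.
    · refine ⟨0, fun ha => ?_, fun h1 h2 => absurd ⟨h1, h2⟩ h⟩
      rw [← Ordinal.cof_pos, (hSω ha).2]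
      exact aleph0_pos
  choose r hrS hrC using hr
  obtain ⟨o, ho⟩ := hS.exists_fiber hκ hκ' hrS
  exact ⟨_, fun a ha => ha.1, ho, Ordinal.lift.{u + 1} o, fun x hx h1 h2 => by
    rw [hrC x h1 h2, hx.2]⟩

/-! ### Enumeration of clubs. -/

/-- The increasing enumeration of a club in a regular cardinal. -/
theorem IsClub.exists_isNormalUpTo {l : Cardinal.{u}} (hl : l.IsRegular)
    {D : Set (Iio l.ord)} (hD : IsClub D) :
    ∃ E : Ordinal.{u} → Ordinal.{u}, IsNormalUpTo l.ord E ∧ E l.ord = l.ord ∧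
      ∀ a < l.ord, ∃ h : E a < l.ord, ⟨E a, h⟩ ∈ D := by
  classical
  have : IsRegularCardinalOrder (Iio l.ord) := ⟨by
    rw [cof_Iio_ord hl, Ordinal.type_lt_Iio, Cardinal.lift_ord]⟩
  let e : Iio l.ord → Iio l.ord := Subtype.val ∘ Order.enum D hD.isCofinal
  have he : Order.IsNormal e := IsClub.isNormal_enum hD
  have hlim : Order.IsSuccLimit l.ord := Cardinal.isSuccLimit_ord hl.aleph0_le
  -- The value `l.ord` at `l.ord` is the supremum of the enumeration, so `E` is continuous at the
  -- top as well.
  let E : Ordinal.{u} → Ordinal.{u} := fun a => if h : a < l.ord then e ⟨a, h⟩ else l.ord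
  have hE : ∀ (a) (h : a < l.ord), E a = e ⟨a, h⟩ := fun a h => dif_pos h
  have hEl : E l.ord = l.ord := dif_neg (lt_irrefl _)
  refine ⟨E, ⟨fun a ha b hb hab => ?_, fun a ha hal p hp => ?_⟩, hEl, fun a ha => ?_⟩
  · have ha' := lt_of_lt_of_le hab hb
    rw [hE a ha']
    rcases lt_or_eq_of_le (show b ≤ l.ord from hb) with h | rfl
    · rw [hE b h]
      exact he.strictMono (show (⟨a, ha'⟩ : Iio l.ord) < ⟨b, h⟩ from hab)
    · rw [hEl]
      exact (e ⟨a, ha'⟩).2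
  · rcases lt_or_eq_of_le ha with h | rfl
    · rw [hE a h] at hp
      by_contra! hcon
      have hlim' : Order.IsSuccLimit (⟨a, h⟩ : Iio l.ord) := by
        refine ⟨fun hmin => hal.1 fun b hb => hmin (b := ⟨b, hb.trans_lt h⟩) hb, fun b hb => ?_⟩
        exact hal.2 b ⟨hb.lt, fun c hbc hca => hb.2 (c := ⟨c, hca.trans h⟩) hbc hca⟩
      have hp' : p < l.ord := hp.trans (e ⟨a, h⟩).2
      have : e ⟨a, h⟩ ≤ ⟨p, hp'⟩ := he.mem_lowerBounds_upperBounds_of_isSuccLimit hlim' (by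
        rintro _ ⟨b, hb, rfl⟩
        have := hcon b hb
        rwa [hE b b.2] at this)
      exact absurd hp (not_lt.2 this)
    · rw [hEl] at hp
      refine ⟨Order.succ p, hlim.succ_lt hp, (Order.lt_succ p).trans_le ?_⟩
      rw [hE _ (hlim.succ_lt hp)]
      exact he.strictMono.le_apply (x := (⟨Order.succ p, hlim.succ_lt hp⟩ : Iio l.ord))
  · rw [hE a ha]
    exact ⟨(e ⟨a, ha⟩).2, (Order.enum D hD.isCofinal ⟨a, ha⟩).2⟩

/-! ### Continuous chains of generated substructures. -/

namespace FirstOrder.Language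

variable {L : Language.{0, 0}} {M : Type (u + 1)} [L.Structure M]

/-- The sequence of substructures generated by `B` together with the sets `F N` for all the earlier
members `N` of the sequence. -/
noncomputable def hullSeq (L : Language.{0, 0}) [L.Structure M] (B : Set M) (F : Set M → Set M)
    (α : Ordinal.{u}) : L.Substructure M :=
  Substructure.closure L (B ∪ ⋃ β : Iio α, F (hullSeq L B F β))
termination_by α
decreasing_by exact β.2

variable {B : Set M} {F : Set M → Set M}

theorem subset_hullSeq (α : Ordinal.{u}) : B ⊆ hullSeq L B F α := by
  rw [hullSeq]
  exact subset_union_left.trans Substructure.subset_closure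

theorem image_subset_hullSeq {α β : Ordinal.{u}} (h : β < α) :
    F (hullSeq L B F β) ⊆ hullSeq L B F α := by
  rw [hullSeq.eq_1 L B F α]
  exact ((subset_iUnion (fun β : Iio α => F (hullSeq L B F β)) ⟨β, h⟩).trans
    subset_union_right).trans Substructure.subset_closure

theorem hullSeq_mono : Monotone (hullSeq L B F : Ordinal.{u} → L.Substructure M) := by
  intro α β h
  rw [hullSeq.eq_1 L B F α, Substructure.closure_le]
  exact union_subset (subset_hullSeq β) (iUnion_subset fun γ =>
    image_subset_hullSeq (lt_of_lt_of_le γ.2 h))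

/-- What stage `γ` contributes through `F` is already present at stage `γ + 1 < α`, and a directed
union of substructures is closed under the finitary functions. -/
theorem mem_hullSeq_limit {α : Ordinal.{u}} (hα : Order.IsSuccLimit α) {x : M} :
    x ∈ hullSeq L B F α ↔ ∃ β < α, x ∈ hullSeq L B F β := by
  refine ⟨fun hx => ?_, fun ⟨β, hβ, hx⟩ => hullSeq_mono hβ.le hx⟩
  have : Nonempty (Iio α) := ⟨⟨0, hα.bot_lt⟩⟩
  have hdir : Directed (· ≤ ·) fun β : Iio α => hullSeq L B F (β : Ordinal.{u}) :=
    Monotone.directed_le fun β γ h => hullSeq_mono h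
  have hle : hullSeq L B F α ≤ ⨆ β : Iio α, hullSeq L B F (β : Ordinal.{u}) := by
    rw [hullSeq.eq_1 L B F α, Substructure.closure_le]
    refine union_subset ?_ (iUnion_subset fun γ => ?_)
    · exact (subset_hullSeq 0).trans (le_iSup (fun β : Iio α => hullSeq L B F (β : Ordinal.{u}))
        ⟨0, hα.bot_lt⟩)
    · exact (image_subset_hullSeq (Order.lt_succ γ.1)).trans
        (le_iSup (fun β : Iio α => hullSeq L B F (β : Ordinal.{u}))
          ⟨Order.succ γ.1, hα.succ_lt γ.2⟩)
  obtain ⟨β, hβ⟩ := (Substructure.mem_iSup_of_directed hdir).1 (hle hx)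
  exact ⟨β, β.2, hβ⟩

theorem card_hullSeq_le {c : Cardinal.{u + 1}} (hc : ℵ₀ ≤ c)
    (hL : #(Σ n, L.Functions n) ≤ ℵ₀) (hB : #B ≤ c) (hF : ∀ s, #(F s) ≤ c)
    {α : Ordinal.{u}} (hα : Cardinal.lift.{u + 1} α.card ≤ c) : #(hullSeq L B F α) ≤ c := by
  have h := Substructure.lift_card_closure_le (L := L)
    (s := B ∪ ⋃ β : Iio α, F (hullSeq L B F (β : Ordinal.{u})))
  rw [← hullSeq.eq_1 L B F α, Cardinal.lift_id'.{0, u + 1}, Cardinal.lift_id'.{0, u + 1}] at h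
  refine h.trans (max_le hc (Cardinal.add_le_of_le hc ?_ ?_))
  · refine (mk_union_le _ _).trans (Cardinal.add_le_of_le hc hB ?_)
    refine (mk_iUnion_le _).trans ?_
    rw [Cardinal.mk_Iio_ordinal]
    exact (mul_le_mul' hα (ciSup_le' fun _ => hF _)).trans (Cardinal.mul_eq_self hc).le
  · exact (Cardinal.lift_le.2 hL).trans (by simpa using hc)

end FirstOrder.Language

open FirstOrder.Language

/-! ### Models and their characteristic functions. -/

section Models

variable {X : ZFSet.{u}} {K : Set Cardinal.{u}}

/-- The elements of `X` that are the supremum of `N ∩ κ`, or its successor, for some `κ ∈ K`. -/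
def supsOf (K : Set Cardinal.{u}) (N : Set X) : Set X :=
  {x | ∃ κ ∈ K, (x : ZFSet.{u}) = (sSup (ordinalsOf N ∩ Iio κ.ord)).toZFSet ∨
    (x : ZFSet.{u}) = (Order.succ (sSup (ordinalsOf N ∩ Iio κ.ord))).toZFSet}

/-- The elements of `X` that are the ordinal `l` or an element of `K`. -/
def baseOf (K : Set Cardinal.{u}) (l : Ordinal.{u}) : Set X :=
  {x | (x : ZFSet.{u}) = l.toZFSet ∨ ∃ κ ∈ K, (x : ZFSet.{u}) = κ.ord.toZFSet}

theorem mk_le_of_val_mem {s : Set X} {t : Set ZFSet.{u}} (h : ∀ x ∈ s, (x : ZFSet.{u}) ∈ t) :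
    #s ≤ #t :=
  Cardinal.mk_le_of_injective (f := fun x : s => (⟨x.1.1, h _ x.2⟩ : t)) fun _ _ hab =>
    Subtype.ext (Subtype.ext (congrArg (fun y : t => y.1) hab))

theorem mk_supsOf_le {c : Cardinal.{u + 1}} (hc : ℵ₀ ≤ c) (hK : #K ≤ c) (N : Set X) :
    #(supsOf K N) ≤ c := by
  let s : Cardinal.{u} → Ordinal.{u} := fun κ => sSup (ordinalsOf N ∩ Iio κ.ord)
  refine (mk_le_of_val_mem (t := (fun κ => (s κ).toZFSet) '' K ∪
    (fun κ => (Order.succ (s κ)).toZFSet) '' K) ?_).trans ?_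
  · rintro x ⟨κ, hκ, h | h⟩
    · exact Or.inl ⟨κ, hκ, h.symm⟩
    · exact Or.inr ⟨κ, hκ, h.symm⟩
  · exact (mk_union_le _ _).trans
      (Cardinal.add_le_of_le hc (mk_image_le.trans hK) (mk_image_le.trans hK))

theorem mk_baseOf_le {c : Cardinal.{u + 1}} (hc : ℵ₀ ≤ c) (hK : #K ≤ c) (l : Ordinal.{u}) :
    #(baseOf K l : Set X) ≤ c := by
  refine (mk_le_of_val_mem (t := {l.toZFSet} ∪ (fun κ : Cardinal.{u} => κ.ord.toZFSet) '' K)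
    ?_).trans ?_
  · rintro x (h | ⟨κ, hκ, h⟩)
    · exact Or.inl h
    · exact Or.inr ⟨κ, hκ, h.symm⟩
  · refine (mk_union_le _ _).trans (Cardinal.add_le_of_le hc ?_ (mk_image_le.trans hK))
    simpa using one_le_aleph0.trans hc

theorem mk_ordinalsOf_le (N : Set X) : #(ordinalsOf N) ≤ #N := by
  choose g hg hgo using fun β : ordinalsOf N => β.2
  refine Cardinal.mk_le_of_injective (f := fun β => (⟨g β, hg β⟩ : N)) fun a b hab => ?_
  have : g a = g b := congrArg Subtype.val hab
  exact Subtype.ext (Ordinal.toZFSet_injective (by rw [← hgo, ← hgo, this]))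

theorem ordinalsOf_mono {N N' : Set X} (h : N ⊆ N') : ordinalsOf N ⊆ ordinalsOf N' :=
  fun _ ⟨x, hx, e⟩ => ⟨x, h hx, e⟩

theorem sSup_ordinalsOf_lt {N : Set X} {κ : Cardinal.{u}} (hκ : κ.IsRegular)
    (hN : #N < Cardinal.lift.{u + 1} κ) : sSup (ordinalsOf N ∩ Iio κ.ord) < κ.ord := by
  refine Ordinal.sSup_lt_of_lt_cof ?_ fun i hi => hi.2
  rw [← Ordinal.lift_cof, hκ.cof_ord]
  exact ((mk_le_mk_of_subset inter_subset_left).trans (mk_ordinalsOf_le N)).trans_lt hN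

theorem le_sSup_ordinalsOf {N : Set X} {κ : Cardinal.{u}} {β : Ordinal.{u}}
    (h : β ∈ ordinalsOf N) (hβ : β < κ.ord) : β ≤ sSup (ordinalsOf N ∩ Iio κ.ord) :=
  le_csSup ⟨κ.ord, fun _ hx => hx.2.le⟩ ⟨h, hβ⟩

variable {L : FirstOrder.Language.{0, 0}} [L.Structure X] {l : Cardinal.{u}}

/-- The sequence of models `N α` that witnesses mutual fatness before thinning out. -/
noncomputable abbrev modelSeq (X : ZFSet.{u}) (L : FirstOrder.Language.{0, 0}) [L.Structure X] (K : Set Cardinal.{u})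
    (l : Cardinal.{u}) (α : Ordinal.{u}) : L.Substructure X :=
  hullSeq L (baseOf K l.ord) (supsOf K) α

/-- The supremum of `N α ∩ κ`. -/
noncomputable abbrev modelSup (X : ZFSet.{u}) (L : FirstOrder.Language.{0, 0}) [L.Structure X] (K : Set Cardinal.{u})
    (l κ : Cardinal.{u}) (α : Ordinal.{u}) : Ordinal.{u} :=
  sSup (ordinalsOf (modelSeq X L K l α : Set X) ∩ Iio κ.ord)

theorem modelSup_lt (hL : #(Σ n, L.Functions n) ≤ ℵ₀) (hl : ℵ₀ ≤ l)
    (hKl : #K < Cardinal.lift.{u + 1} l) {κ : Cardinal.{u}} (hκ : κ.IsRegular) (hlκ : l < κ)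
    {α : Ordinal.{u}} (hα : α ≤ l.ord) : modelSup X L K l κ α < κ.ord := by
  refine sSup_ordinalsOf_lt hκ ((card_hullSeq_le (c := Cardinal.lift.{u + 1} l) (by simpa using hl)
    hL (mk_baseOf_le (by simpa using hl) hKl.le _)
    (fun s => mk_supsOf_le (by simpa using hl) hKl.le s) ?_).trans_lt (Cardinal.lift_lt.2 hlκ))
  rw [Cardinal.lift_le]
  simpa using Ordinal.card_le_card hα

theorem modelSup_mem {κ : Cardinal.{u}} (hκ : κ ∈ K) (hX : ∀ β < κ.ord, β.toZFSet ∈ X)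
    {α β : Ordinal.{u}} (hlt : modelSup X L K l κ β < κ.ord) (h : β < α) :
    modelSup X L K l κ β ∈ ordinalsOf (modelSeq X L K l α : Set X) :=
  ⟨⟨_, hX _ hlt⟩, image_subset_hullSeq h ⟨κ, hκ, Or.inl rfl⟩, rfl⟩

theorem succ_modelSup_mem {κ : Cardinal.{u}} (hκ : κ ∈ K) (hX : ∀ β < κ.ord, β.toZFSet ∈ X)
    {α β : Ordinal.{u}} (hlt : Order.succ (modelSup X L K l κ β) < κ.ord) (h : β < α) :
    Order.succ (modelSup X L K l κ β) ∈ ordinalsOf (modelSeq X L K l α : Set X) :=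
  ⟨⟨_, hX _ hlt⟩, image_subset_hullSeq h ⟨κ, hκ, Or.inr rfl⟩, rfl⟩

/-- Later models contain the successor of the supremum; containing the supremum alone would not
force a strict increase. Continuity holds because limit models are unions. -/
theorem isNormalUpTo_modelSup (hL : #(Σ n, L.Functions n) ≤ ℵ₀) (hl : ℵ₀ ≤ l)
    (hKl : #K < Cardinal.lift.{u + 1} l) {κ : Cardinal.{u}} (hκ : κ.IsRegular) (hlκ : l < κ)
    (hκK : κ ∈ K) (hX : ∀ β < κ.ord, β.toZFSet ∈ X) :
    IsNormalUpTo l.ord (modelSup X L K l κ) := by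
  have hlim : Order.IsSuccLimit κ.ord := Cardinal.isSuccLimit_ord hκ.aleph0_le
  refine ⟨fun a ha b hb hab => ?_, fun a ha hal p hp => ?_⟩
  · have h := hlim.succ_lt (modelSup_lt (X := X) hL hl hKl hκ hlκ ha)
    exact (Order.lt_succ _).trans_le (le_sSup_ordinalsOf (succ_modelSup_mem hκK hX h hab) h)
  · obtain ⟨q, ⟨⟨x, hx, hxq⟩, hqκ⟩, hpq⟩ := exists_lt_of_lt_csSup' hp
    obtain ⟨b, hb, hxb⟩ := (mem_hullSeq_limit hal).1 hx
    exact ⟨b, hb, hpq.trans_le (le_sSup_ordinalsOf ⟨x, hxb, hxq⟩ hqκ)⟩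

end Models

/-! ### Thinning the chain and conclusion. -/

/-- Fewer than `l` clubs of `l` meet in a club, which `E` enumerates. The top index lies in no club
of `l`, but there `f κ l.ord` has cofinality `l > ω`, while points of `T κ` have cofinality `ω`. -/
theorem exists_isNormalUpTo_forall_notMem {K : Set Cardinal.{u}} {l : Cardinal.{u}}
    (hl : l.IsRegular) (hl' : ℵ₀ < l) (hKl : #K < Cardinal.lift.{u + 1} l)
    {θ : Ordinal.{u}} {C : Ordinal.{u} → Set Ordinal.{u}} (hC : IsSquareSequence θ C)
    {f : Cardinal.{u} → Ordinal.{u} → Ordinal.{u}} {T : Cardinal.{u} → Set Ordinal.{u}}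
    (hf : ∀ κ ∈ K, IsNormalUpTo l.ord (f κ) ∧ l.ord ≤ f κ 0 ∧ f κ l.ord < θ)
    (hTω : ∀ κ ∈ K, T κ ⊆ cofOmega κ)
    (hT : ∀ κ ∈ K, ∃ o, ∀ x ∈ T κ, x < θ → IsSingularOrdinal x → otp (C x) = o) :
    ∃ E, IsNormalUpTo l.ord E ∧ E l.ord = l.ord ∧ ∀ a ≤ l.ord, ∀ κ ∈ K, f κ (E a) ∉ T κ := by
  have hlim : Order.IsSuccLimit l.ord := Cardinal.isSuccLimit_ord hl.aleph0_le
  have hD : ∀ κ : K, ∃ D : Set (Iio l.ord), IsClub D ∧ ∀ a ∈ D, f κ a ∉ T κ := by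
    rintro ⟨κ, hκ⟩
    obtain ⟨o, ho⟩ := hT κ hκ
    obtain ⟨h1, h2, h3⟩ := hf κ hκ
    exact hC.exists_isClub_forall_notMem hl hl' h1 h2 h3 ho
  choose D hD hDT using hD
  have hI : IsClub (⋂ κ, D κ) := by
    refine IsClub.iInter ?_ ?_ hD
    · rw [cof_Iio_ord hl]
      exact (by simpa using hl' : ℵ₀ < Cardinal.lift.{u + 1} l).ne'
    · rw [cof_Iio_ord hl, Cardinal.lift_id, Cardinal.lift_id]
      exact hKl
  obtain ⟨E, hE, hEl, hED⟩ := hI.exists_isNormalUpTo hl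
  refine ⟨E, hE, hEl, fun a ha κ hκ => ?_⟩
  rcases lt_or_eq_of_le ha with h | rfl
  · obtain ⟨h1, h2⟩ := hED a h
    exact hDT ⟨κ, hκ⟩ _ (mem_iInter.1 h2 ⟨κ, hκ⟩)
  · rw [hEl]
    intro hmem
    have hcof := (hTω κ hκ hmem).2
    rw [(hf κ hκ).1.cof_apply le_rfl hlim, hl.cof_ord] at hcof
    exact hl'.ne' hcof

theorem isStronglyMutuallyNuFat_of_square {K : Set Cardinal.{u}} (hne : K.Nonempty)
    {l : Cardinal.{u}} (hl : l.IsRegular) (hl' : ℵ₀ < l) (hKl : #K < Cardinal.lift.{u + 1} l)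
    (hK : ∀ κ ∈ K, κ.IsRegular ∧ l < κ ∧ κ ≤ sSup K)
    {C : Ordinal.{u} → Set Ordinal.{u}} (hC : IsSquareSequence (Order.succ (sSup K).ord) C)
    {T : Cardinal.{u} → Set Ordinal.{u}} (hTω : ∀ κ ∈ K, T κ ⊆ cofOmega κ)
    (hT : ∀ κ ∈ K, ∃ o, ∀ x ∈ T κ, x < Order.succ (sSup K).ord → IsSingularOrdinal x →
      otp (C x) = o) {ν : Cardinal.{u}} (hν : ν ≤ l) :
    IsStronglyMutuallyNuFat K (fun κ => Iio κ.ord \ T κ) ν := by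
  intro X hX hKX L _ _
  obtain ⟨κ₁, hκ₁⟩ := hne
  have : Nonempty X := ⟨⟨_, hKX κ₁ hκ₁⟩⟩
  -- Adding Skolem functions keeps the language countable and makes every generated substructure
  -- elementary for `L`.
  have hL : #(Σ n, (L.sum L.skolem₁).Functions n) ≤ ℵ₀ := by
    refine card_functions_sum_skolem₁_le.trans (max_le le_rfl ?_)
    exact Cardinal.mk_le_aleph0
  have hXκ : ∀ κ ∈ K, ∀ β < κ.ord, β.toZFSet ∈ X := fun κ hκ β hβ =>
    hX β (hβ.trans_le (Cardinal.ord_le_ord.2 (hK κ hκ).2.2))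
  let f := modelSup X (L.sum L.skolem₁) K l
  have hfn : ∀ κ ∈ K, IsNormalUpTo l.ord (f κ) := fun κ hκ =>
    isNormalUpTo_modelSup hL hl'.le hKl (hK κ hκ).1 (hK κ hκ).2.1 hκ (hXκ κ hκ)
  have hfκ : ∀ κ ∈ K, ∀ α ≤ l.ord, f κ α < κ.ord := fun κ hκ α hα =>
    modelSup_lt hL hl'.le hKl (hK κ hκ).1 (hK κ hκ).2.1 hα
  have hlX : ∀ κ ∈ K, l.ord < κ.ord := fun κ hκ => Cardinal.ord_lt_ord.2 (hK κ hκ).2.1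
  have hf0 : ∀ κ ∈ K, l.ord ≤ f κ 0 := fun κ hκ => le_sSup_ordinalsOf
    (N := (modelSeq X (L.sum L.skolem₁) K l 0 : Set X))
    ⟨⟨l.ord.toZFSet, hXκ κ hκ _ (hlX κ hκ)⟩, subset_hullSeq 0 (Or.inl rfl), rfl⟩ (hlX κ hκ)
  obtain ⟨E, hE, hEl, hET⟩ := exists_isNormalUpTo_forall_notMem hl hl' hKl hC
    (fun κ hκ => ⟨hfn κ hκ, hf0 κ hκ, (hfκ κ hκ _ le_rfl).trans_le
      ((Cardinal.ord_le_ord.2 (hK κ hκ).2.2).trans (Order.le_succ _))⟩) hTω hT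
  have hνl : ν.ord ≤ l.ord := Cardinal.ord_le_ord.2 hν
  have hEle : ∀ α ≤ l.ord, E α ≤ l.ord := fun α hα =>
    (hE.strictMonoOn.monotoneOn hα (le_refl l.ord) hα).trans hEl.le
  refine ⟨fun α => (modelSeq X (L.sum L.skolem₁) K l (E α)).elementarySkolem₁Reduct,
    ⟨fun a ha b hb hab => ?_, fun a ha hal => ?_, fun a ha κ hκ _ => ?_, fun a ha κ hκ _ => ?_⟩,
    fun a ha κ hκ => ?_⟩
  · have ha' := le_trans ha hνl
    have hEab := hE.strictMonoOn ha' (le_trans hb hνl) hab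
    -- The inclusion is proper because the suprema below `κ₁` differ.
    refine lt_of_le_not_ge (hullSeq_mono hEab.le) fun hle => ?_
    have h := hfn κ₁ hκ₁ |>.strictMonoOn (hEle a ha') (hEle b (le_trans hb hνl)) hEab
    refine absurd h (not_lt.2 ?_)
    exact csSup_le_csSup' ⟨κ₁.ord, fun _ hx => hx.2.le⟩
      (inter_subset_inter_left _ (ordinalsOf_mono hle))
  · have ha' := ha.trans hνl
    ext x
    simp only [mem_iUnion]
    refine (mem_hullSeq_limit (hE.isSuccLimit ha' hal)).trans ⟨fun ⟨c, hc, hx⟩ => ?_,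
      fun ⟨b, hb, hx⟩ => ⟨E b, hE.strictMonoOn ((le_of_lt hb).trans ha') ha' hb, hx⟩⟩
    obtain ⟨b, hb, hcb⟩ := hE.exists_lt a ha' hal c hc
    exact ⟨b, hb, hullSeq_mono hcb.le hx⟩
  · exact ⟨hfκ κ hκ _ (hEle a (ha.trans hνl)), hET a (ha.trans hνl) κ hκ⟩
  · have ha' := ha.trans_le hνl
    have hs : Order.succ a ≤ l.ord := Order.succ_le_of_lt ha'
    exact modelSup_mem hκ (hXκ κ hκ) (hfκ κ hκ _ (hEle a ha'.le))
      (hE.strictMonoOn ha'.le hs (Order.lt_succ a))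
  · exact ⟨⟨_, hKX κ hκ⟩, subset_hullSeq (E a) (Or.inr ⟨κ, hκ, rfl⟩), rfl⟩

theorem mainTheorem6
    (K : Set Cardinal.{u}) (κ₀ : Cardinal.{u}) (hκ₀ : IsLeast K κ₀)
    (hreg : ∀ κ ∈ K, κ.IsRegular ∧ ℵ₀ < κ)
    (hcard : Order.succ #K < Cardinal.lift.{u + 1} κ₀)
    (hsing : ¬ ∃ c : Cardinal.{u}, c.IsSingular ∧ κ₀ = Order.succ c)
    (ψ : Cardinal.{u}) (hψ : Order.succ (Order.succ ψ) < κ₀) (hGCH : GCHFrom ψ)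
    (C : Ordinal.{u} → Set Ordinal.{u})
    (hC : IsSquareSequence (Order.succ (sSup K).ord) C)
    (S : Cardinal.{u} → Set Ordinal.{u})
    (hS : ∀ κ ∈ K, S κ ⊆ cofOmega κ ∧ IsStationaryIn κ.ord (S κ)) :
    ∃ S' : Cardinal.{u} → Set Ordinal.{u},
      (∀ κ ∈ K, S' κ ⊆ S κ ∧ IsStationaryIn κ.ord (S' κ)) ∧
        IsStronglyMutuallyFat K (fun κ => Iio κ.ord \ S' κ) := by
  have hT : ∀ κ, ∃ T : Set Ordinal.{u}, κ ∈ K → T ⊆ S κ ∧ IsStationaryIn κ.ord T ∧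
      ∃ o, ∀ x ∈ T, x < Order.succ (sSup K).ord → IsSingularOrdinal x → otp (C x) = o := by
    intro κ
    by_cases hκ : κ ∈ K
    · obtain ⟨T, hT⟩ := hC.exists_stationary_otp_const (hreg κ hκ).1 (hreg κ hκ).2
        (hS κ hκ).1 (hS κ hκ).2
      exact ⟨T, fun _ => hT⟩
    · exact ⟨∅, fun h => absurd h hκ⟩
  choose T hT using hT
  refine ⟨T, fun κ hκ => ⟨(hT κ hκ).1, (hT κ hκ).2.1⟩, fun ν hν hνK => ?_⟩
  -- `k` is the cardinality of `K` brought down to universe `u`; the length of the chain will be `l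
  -- = max ν (max k ℵ₀)⁺`.
  obtain ⟨k, -, hk⟩ := Cardinal.lt_lift_iff.1 ((Order.lt_succ #K).trans hcard)
  have hbdd : BddAbove K := by
    rw [Cardinal.bddAbove_iff_small, Cardinal.small_iff_lift_mk_lt_univ, ← hk, Cardinal.lift_lift]
    exact Cardinal.lift_lt_univ' k
  -- For countable `K` this is `ℵ₁ < κ₀`, which follows from `ℵ₀ ≤ ψ` and `ψ⁺⁺ < κ₀`.
  have hm : Order.succ (max k ℵ₀) < κ₀ := by
    rcases le_total k ℵ₀ with h | h
    · rw [max_eq_right h]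
      exact (Order.succ_le_succ (hGCH.1.trans (Order.le_succ ψ))).trans_lt hψ
    · rw [max_eq_left h]
      rwa [← hk, ← Cardinal.lift_succ, Cardinal.lift_lt] at hcard
  have hmreg : (Order.succ (max k ℵ₀)).IsRegular := Cardinal.isRegular_succ (le_max_right _ _)
  have hml : Order.succ (max k ℵ₀) ≤ max ν (Order.succ (max k ℵ₀)) := le_max_right _ _
  have hl : (max ν (Order.succ (max k ℵ₀))).IsRegular := by
    rcases max_choice ν (Order.succ (max k ℵ₀)) with h | h <;> rw [h] <;> assumption
  refine isStronglyMutuallyNuFat_of_square ⟨κ₀, hκ₀.1⟩ hl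
    ((Order.lt_succ_of_le (le_max_right _ _)).trans_le hml) ?_
    (fun κ hκ => ⟨(hreg κ hκ).1, max_lt (hνK κ hκ) (hm.trans_le (hκ₀.2 hκ)), le_csSup hbdd hκ⟩)
    hC (fun κ hκ => (hT κ hκ).1.trans (hS κ hκ).1) (fun κ hκ => (hT κ hκ).2.2) (le_max_left _ _)
  rw [← hk, Cardinal.lift_lt]
  exact (Order.lt_succ_of_le (le_max_left _ _)).trans_le hml
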